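/- Let $R$ be a commutative ring. Complexes of $R$-modules are graded homologically, with differentials $d_i\colon X_i\to X_{i-1}$, and an $R$-module is viewed as a complex concentrated in degree $0$. For complexes $X,Y$, the complex $\mathrm{Hom}_R(X,Y)$ is given by $\mathrm{Hom}_R(X,Y)_n=\prod_i\mathrm{Hom}_R(X_i,Y_{i+n})$ and $d(\varphi)=d^Y\varphi-(-1)^{n}\varphi d^X$ for $\varphi$ of degree $n$. An acyclic complex $T$ of projective $R$-modules is \emph{totally acyclic} if $\mathrm{Hom}_R(T,Q)$ is acyclic for every projective $R$-module $Q$. A complex $U$ of injective $R$-modules is \emph{totally acyclic} if it is acyclic and $\mathrm{Hom}_R(J,U)$ is acyclic for every injective $R$-module $J$. A module $M$ is \emph{Gorenstein projective with complete projective resolution} $T$ if $T$ is a totally acyclic complex of projective modules with $\mathrm{Coker}(T_1\to T_0)\cong M$. A module $N$ is \emph{Gorenstein injective with complete injective resolution} $U$ if $U$ is a totally acyclic complex of injective modules with $\mathrm{Ker}(U_0\to U_{-1})\cong N$. For such $M$ and $T$, every $R$-module $L$ and every $i\in\mathbb Z$, the \emph{Tate cohomology} is $\widehat{\mathrm{Ext}}{}^i_R(M,L)=H_{-i}(\mathrm{Hom}_R(T,L))$.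 Let $X_{\le n}$ and $X_{\ge n}$ denote the hard truncations of $X$, and let $\Sigma^{-1}X$ be the shift with $(\Sigma^{-1}X)_i=X_{i+1}$ and $d^{\Sigma^{-1}X}_i=-d^X_{i+1}$. The \emph{pinched Hom} $\mathrm{Hom}^{\bowtie}_R(T,A)$ of complexes $T$ and $A$ is the complex that agrees with $\mathrm{Hom}_R(T_{\le -1},\Sigma^{-1}(A_{\ge 1}))$ in degrees $n\ge 1$ (with its differentials $d_n$ for $n\ge 2$) and with $\mathrm{Hom}_R(T_{\ge 0},A_{\le 0})$ in degrees $n\le 0$ (with its differentials $d_n$ for $n\le 0$), and whose differential from degree $1$ to degree $0$ sends $\varphi$, with component $\varphi_{-1}\colon T_{-1}\to(\Sigma^{-1}A)_0=A_1$, to $d^A_1\circ\varphi_{-1}\circ d^T_0\colon T_0\to A_0$. \textbf{Corollary.} Let $M$ be a Gorenstein projective $R$-module with complete projective resolution $T$, and let $N$ be a Gorenstein injective $R$-module with complete injective resolution $U$. If $\widehat{\mathrm{Ext}}{}^i_R(M,N)=0$ for all $i\in\mathbb Z$, then $\mathrm{Hom}^{\bowtie}_R(T,U)$ is an acyclic complex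 of injective $R$-modules, and the following conditions are equivalent: (i) the complex $\mathrm{Hom}^{\bowtie}_R(T,U)$ of injective $R$-modules is totally acyclic; (ii) for every injective $R$-module $J$ one has $\widehat{\mathrm{Ext}}{}^i_R(M,\mathrm{Hom}_R(J,N))=0$ for all $i\in\mathbb Z$. When these conditions hold, the $R$-module $\mathrm{Hom}_R(M,N)$ is Gorenstein injective with complete injective resolution $\mathrm{Hom}^{\bowtie}_R(T,U)$. -/

import Mathlib

open CategoryTheory

universe u v

/-!
Complexes are homologically graded: an `R`-complex is a `ChainComplex (ModuleCat R) ℤ`, with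
differential `M.d i (i - 1) : M_i ⟶ M_{i-1}`.
-/

namespace PinchedHom

variable {R : Type u} [CommRing R]

noncomputable section

theorem dd_apply (K : ChainComplex (ModuleCat.{v} R) ℤ) (i j k : ℤ) (x : K.X i) :
    (K.d j k).hom ((K.d i j).hom x) = 0 := by
  rw [← LinearMap.comp_apply, ← ModuleCat.hom_comp, K.d_comp_d]
  rfl

/-- The complex `Hom_R(T, N)` for an `R`-complex `T` and an `R`-module `N` (viewed as a complex
concentrated in degree `0`): in degree `n` it is `Hom_R(T_{-n}, N)`, and the differential is
`d(φ) = -(-1)^n φ ∘ d^T` for `φ` of degree `n`. -/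
def homToModule (T : ChainComplex (ModuleCat.{v} R) ℤ) (N : ModuleCat.{v} R) :
    ChainComplex (ModuleCat.{v} R) ℤ where
  X n := ModuleCat.of R (T.X (-n) →ₗ[R] N)
  d n m := ModuleCat.ofHom
    (-(n.negOnePow • (LinearMap.lcomp R N (T.d (-m) (-n)).hom :
      (T.X (-n) →ₗ[R] N) →ₗ[R] (T.X (-m) →ₗ[R] N))))
  shape n m h := by
    have h0 : T.d (-m) (-n) = 0 := T.shape _ _ (by simp at h ⊢; omega)
    ext φ x
    simp [h0]
  d_comp_d' i j k _ _ := by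
    ext φ : 2
    refine LinearMap.ext (M := T.X (-k)) (M₃ := N) fun x => ?_
    simp [Units.smul_def, dd_apply]

/-- The complex `Hom_R(J, U)` for an `R`-module `J` and an `R`-complex `U`: in degree `n` it is
`Hom_R(J, U_n)`, and the differential is `d(φ) = d^U ∘ φ`. -/
def homFromModule (J : ModuleCat.{v} R) (U : ChainComplex (ModuleCat.{v} R) ℤ) :
    ChainComplex (ModuleCat.{v} R) ℤ where
  X n := ModuleCat.of R (J →ₗ[R] U.X n)
  d n m := ModuleCat.ofHom ((U.d n m).hom.compRight R : (J →ₗ[R] U.X n) →ₗ[R] (J →ₗ[R] U.X m))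
  shape n m h := by
    ext φ x
    simp [U.shape n m h]
  d_comp_d' i j k _ _ := by
    ext φ : 2
    refine LinearMap.ext (M := J) (M₃ := U.X k) fun x => ?_
    exact dd_apply U i j k (φ x)

/-- A complex `T` of projective modules is totally acyclic if `T` is acyclic and `Hom_R(T, Q)` is
acyclic for every projective module `Q`. -/
structure IsTotallyAcyclicProjective (T : ChainComplex (ModuleCat.{v} R) ℤ) : Prop where
  projective : ∀ i, Module.Projective R (T.X i)
  acyclic : T.Acyclic
  hom_acyclic : ∀ Q : ModuleCat.{v} R, Module.Projective R Q → (homToModule T Q).Acyclic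

/-- A complex `U` of injective modules is totally acyclic if `U` is acyclic and `Hom_R(J, U)` is
acyclic for every injective module `J`. -/
structure IsTotallyAcyclicInjective (U : ChainComplex (ModuleCat.{v} R) ℤ) : Prop where
  injective : ∀ i, Module.Injective R (U.X i)
  acyclic : U.Acyclic
  hom_acyclic : ∀ J : ModuleCat.{v} R, Module.Injective R J → (homFromModule J U).Acyclic

/-- `T` is a complete projective resolution of the (Gorenstein projective) module `M`: a totally
acyclic complex of projective modules with `Coker (T_1 ⟶ T_0) ≅ M`. -/
structure IsCompleteProjectiveResolution (T : ChainComplex (ModuleCat.{v} R) ℤ)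
    (M : ModuleCat.{v} R) : Prop where
  totallyAcyclic : IsTotallyAcyclicProjective T
  coker : Nonempty ((T.X 0 ⧸ LinearMap.range (T.d 1 0).hom) ≃ₗ[R] M)

/-- `U` is a complete injective resolution of the (Gorenstein injective) module `N`: a totally
acyclic complex of injective modules with `Ker (U_0 ⟶ U_{-1}) ≅ N`. -/
structure IsCompleteInjectiveResolution (U : ChainComplex (ModuleCat.{v} R) ℤ)
    (N : ModuleCat.{v} R) : Prop where
  totallyAcyclic : IsTotallyAcyclicInjective U
  ker : Nonempty (LinearMap.ker (U.d 0 (-1)).hom ≃ₗ[R] N)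

/-- Gorenstein projective modules. -/
def IsGorensteinProjective (M : ModuleCat.{v} R) : Prop :=
  ∃ T : ChainComplex (ModuleCat.{v} R) ℤ, IsCompleteProjectiveResolution T M

/-- Gorenstein injective modules. -/
def IsGorensteinInjective (N : ModuleCat.{v} R) : Prop :=
  ∃ U : ChainComplex (ModuleCat.{v} R) ℤ, IsCompleteInjectiveResolution U N

/-- Tate cohomology `Êxt^i_R(M, N) = H_{-i}(Hom_R(T, N))`, where `T` is a complete projective
resolution of `M`. -/
def tateExt (T : ChainComplex (ModuleCat.{v} R) ℤ) (N : ModuleCat.{v} R) (i : ℤ) :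
    ModuleCat.{v} R :=
  (homToModule T N).homology (-i)

/-- The pairs `(p, q)` for which `Hom_R(T_p, A_q)` is a factor of the pinched Hom in degree `n`.

For `n ≥ 1` these are the factors of `Hom(T_{≤ -1}, Σ⁻¹(A_{≥ 1}))_n`; recall that
`(Σ⁻¹ A)_i = A_{i+1}`. For `n ≤ 0` these are the factors of `Hom(T_{≥ 0}, A_{≤ 0})_n`. -/
def PinchIndex (n p q : ℤ) : Prop :=
  (1 ≤ n ∧ p ≤ -1 ∧ 1 ≤ q ∧ q = p + n + 1) ∨ (n ≤ 0 ∧ 0 ≤ p ∧ q ≤ 0 ∧ q = p + n)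

variable (T A : ChainComplex (ModuleCat.{v} R) ℤ)

/-- The degree `n` component of the pinched Hom of `T` and `A`. -/
abbrev Pinched (n : ℤ) : Type v :=
  (s : {s : ℤ × ℤ // PinchIndex n s.1 s.2}) → (T.X s.1.1 →ₗ[R] A.X s.1.2)

variable {T A}

open Classical in
/-- The component `T_p → A_q` of `φ`; it is `0` if `Hom_R(T_p, A_q)` is not a factor of the pinched
Hom in degree `n`. -/
def Pinched.comp {n : ℤ} (φ : Pinched T A n) (p q : ℤ) : T.X p →ₗ[R] A.X q :=
  if h : PinchIndex n p q then φ ⟨(p, q), h⟩ else 0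

theorem Pinched.comp_eq {n : ℤ} (φ : Pinched T A n) {p q : ℤ} (h : PinchIndex n p q) :
    φ.comp p q = φ ⟨(p, q), h⟩ := by
  simp [Pinched.comp, h]

theorem Pinched.comp_eq_zero {n : ℤ} (φ : Pinched T A n) {p q : ℤ} (h : ¬ PinchIndex n p q) :
    φ.comp p q = 0 := by
  simp [Pinched.comp, h]

theorem Pinched.comp_add {n : ℤ} (φ ψ : Pinched T A n) (p q : ℤ) :
    Pinched.comp (φ + ψ) p q = φ.comp p q + ψ.comp p q := by
  by_cases h : PinchIndex n p q <;> simp [Pinched.comp, h]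

theorem Pinched.comp_smul {n : ℤ} (r : R) (φ : Pinched T A n) (p q : ℤ) :
    Pinched.comp (r • φ) p q = r • φ.comp p q := by
  by_cases h : PinchIndex n p q <;> simp [Pinched.comp, h]

variable (T A)

/-- The component `T_p → A_q` of the differential of `φ`, for `φ` of degree `n` in the pinched Hom.

* For `n ≥ 2` the differential is that of `Hom(T_{≤ -1}, Σ⁻¹(A_{≥ 1}))`, that is,
  `φ ↦ d^{Σ⁻¹A} φ - (-1)^n φ d^T`, where `d^{Σ⁻¹A} = -d^A`.
* For `n = 1` it is `φ ↦ d^A_1 ∘ φ ∘ d^T_0`, where `φ : T_{-1} → (Σ⁻¹A)_0 = A_1`.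
* For `n ≤ 0` it is that of `Hom(T_{≥ 0}, A_{≤ 0})`, that is, `φ ↦ d^A φ - (-1)^n φ d^T`. -/
def pinchedDComp {n : ℤ} (φ : Pinched T A n) (p q : ℤ) : T.X p →ₗ[R] A.X q :=
  if 2 ≤ n then
    -((A.d (q + 1) q).hom ∘ₗ φ.comp p (q + 1))
      - n.negOnePow • (φ.comp (p - 1) q ∘ₗ (T.d p (p - 1)).hom)
  else if n = 1 then
    (A.d 1 q).hom ∘ₗ φ.comp (-1) 1 ∘ₗ (T.d p (-1)).hom
  else
    (A.d (q + 1) q).hom ∘ₗ φ.comp p (q + 1)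
      - n.negOnePow • (φ.comp (p - 1) q ∘ₗ (T.d p (p - 1)).hom)

/-- The differential of the pinched Hom from degree `n` to degree `m = n - 1`. -/
def pinchedD (n m : ℤ) : Pinched T A n →ₗ[R] Pinched T A m where
  toFun φ s := pinchedDComp T A φ s.1.1 s.1.2
  map_add' φ ψ := by
    funext s
    ext x
    simp only [pinchedDComp, Pinched.comp_add, Pi.add_apply]
    split_ifs <;> simp [Units.smul_def] <;> abel
  map_smul' r φ := by
    funext s
    ext x
    simp only [pinchedDComp, Pinched.comp_smul, Pi.smul_apply, RingHom.id_apply]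
    split_ifs <;> simp [Units.smul_def, smul_sub, smul_comm r]

theorem pinchedD_comp_apply {n m : ℤ} (φ : Pinched T A n) (p q : ℤ) (h : PinchIndex m p q) :
    (pinchedD T A n m φ).comp p q = pinchedDComp T A φ p q := by
  rw [Pinched.comp_eq _ h]
  rfl

theorem pinchedD_comp_apply_of_nonpos {n m : ℤ} (hm : m + 1 = n) (hn : n ≤ 0)
    (φ : Pinched T A n) (p q : ℤ) :
    (pinchedD T A n m φ).comp p q = pinchedDComp T A φ p q := by
  by_cases h : PinchIndex m p q
  · exact pinchedD_comp_apply T A φ p q h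
  · have h1 : φ.comp p (q + 1) = 0 :=
      Pinched.comp_eq_zero _ (by unfold PinchIndex at h ⊢; omega)
    have h2 : φ.comp (p - 1) q = 0 :=
      Pinched.comp_eq_zero _ (by unfold PinchIndex at h ⊢; omega)
    rw [Pinched.comp_eq_zero _ h, pinchedDComp, if_neg (by omega), if_neg (by omega), h1, h2]
    simp

theorem pinchedD_comp_pinchedD (n m k : ℤ) (hm : m + 1 = n) (hk : k + 1 = m)
    (φ : Pinched T A n) : pinchedD T A m k (pinchedD T A n m φ) = 0 := by
  funext ⟨⟨p, q⟩, h⟩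
  change pinchedDComp T A (pinchedD T A n m φ) p q = 0
  ext x
  have h' := h
  unfold PinchIndex at h'
  dsimp only at h'
  subst hm
  subst hk
  by_cases c1 : 2 ≤ k + 1
  · rw [pinchedDComp, if_pos c1,
      pinchedD_comp_apply T A φ p (q + 1) (by unfold PinchIndex; omega),
      pinchedD_comp_apply T A φ (p - 1) q (by unfold PinchIndex; omega)]
    simp only [pinchedDComp]
    rw [if_pos (by omega), if_pos (by omega)]
    simp [Units.smul_def, dd_apply, Int.negOnePow_succ]
  by_cases c2 : k + 1 = 1
  · obtain rfl : k = 0 := by omega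
    obtain rfl : p = 0 := by omega
    obtain rfl : q = 0 := by omega
    rw [pinchedDComp, if_neg c1, if_pos c2,
      pinchedD_comp_apply T A φ (-1) 1 (by unfold PinchIndex; omega), pinchedDComp,
      if_pos (by omega)]
    simp [Units.smul_def, dd_apply]
  by_cases c3 : k + 1 = 0
  · obtain rfl : k = -1 := by omega
    rw [pinchedDComp, if_neg c1, if_neg c2]
    obtain ⟨rfl, rfl⟩ | ⟨rfl, rfl⟩ : (p = 0 ∧ q = -1) ∨ (p = 1 ∧ q = 0) := by omega
    · rw [Pinched.comp_eq_zero (p := 0 - 1) _ (by unfold PinchIndex; omega),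
        pinchedD_comp_apply T A φ 0 (-1 + 1) (by unfold PinchIndex; omega), pinchedDComp,
        if_neg (by omega), if_pos (by omega)]
      simp [dd_apply]
    · rw [Pinched.comp_eq_zero (p := 1) _ (by unfold PinchIndex; omega),
        pinchedD_comp_apply T A φ (1 - 1) 0 (by unfold PinchIndex; omega), pinchedDComp,
        if_neg (by omega), if_pos (by omega)]
      simp [dd_apply]
  · rw [pinchedDComp, if_neg c1, if_neg c2,
      pinchedD_comp_apply_of_nonpos T A rfl (by omega),
      pinchedD_comp_apply_of_nonpos T A rfl (by omega)]
    simp only [pinchedDComp]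
    rw [if_neg (by omega), if_neg (by omega), if_neg (by omega), if_neg (by omega)]
    simp [Units.smul_def, dd_apply, Int.negOnePow_succ]

/-- The pinched Hom complex of `T` and `A`. -/
def pinchedHom : ChainComplex (ModuleCat.{v} R) ℤ where
  X n := ModuleCat.of R (Pinched T A n)
  d n m := if m + 1 = n then ModuleCat.ofHom (pinchedD T A n m) else 0
  shape n m h := if_neg h
  d_comp_d' n m k hm hk := by
    have hm' : m + 1 = n := hm
    have hk' : k + 1 = m := hk
    rw [if_pos hm', if_pos hk']
    ext φ : 2
    exact pinchedD_comp_pinchedD T A n m k hm' hk' φ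

end

end PinchedHom

namespace PinchedHom

variable {R : Type u} [CommRing R]

/-! The pinched Hom computes Tate cohomology. Let `A` be acyclic with `L = Ker (A_0 → A_{-1})`. Then
`A` is spliced at `L`: `d_1` factors as a surjection `π : A_1 → L` followed by an injection `ι : L →
A_0`, so `A_{≥1}` is a left resolution and `A_{≤0}` a right resolution of `L`. Each `T_p` is
projective, so `Hom(T_p, -)` keeps both exact. The two halves of the pinched Hom therefore compute
`Hom(T_{≤-1}, L)` and `Hom(T_{≥0}, L)`, and the map `φ ↦ d_1 φ d_0` glues them to `Hom(T, L)`. This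
gives `acyclic_pinchedHom_iff`: the pinched Hom is acyclic exactly when `Hom(T, L)` is.

The comparison is made by hand. Degree `n` has finitely many components, and exactness of `A` lets
them be cleared one at a time. What remains is the component on `T_{-n}`: for `n ≤ 0` it lands in
`A_0` and factors through `ι`; for `n ≥ 1` it lands in `A_1` and is pushed to `L` by `π`.

With `A = U`, `L = N` this is the first assertion. Swapping arguments identifies `Hom(J, Hom^⋈(T,
U))` with `Hom^⋈(T, Hom(J, U))`, and the criterion with `A = Hom(J, U)`, `L = Hom(J, N)` gives the
equivalence. -/

/-! ### Elementwise acyclicity, lifting, and injectivity of the pinched Hom -/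

theorem acyclic_iff (K : ChainComplex (ModuleCat.{v} R) ℤ) :
    K.Acyclic ↔ ∀ i j k : ℤ, j + 1 = i → k + 1 = j → ∀ x : K.X j, (K.d j k).hom x = 0 →
      ∃ y : K.X i, (K.d i j).hom y = x := by
  have key (i j k : ℤ) (hi : j + 1 = i) (hk : k + 1 = j) : K.ExactAt j ↔
      ∀ x : K.X j, (K.d j k).hom x = 0 → ∃ y : K.X i, (K.d i j).hom y = x := by
    rw [K.exactAt_iff' i j k (by simp [hi]) (by simp; omega), ShortComplex.moduleCat_exact_iff]
    rfl
  constructor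
  · intro h i j k hi hk
    exact (key i j k hi hk).1 (h j)
  · intro h j
    exact (key (j + 1) j (j - 1) rfl (by omega)).2 (h _ _ _ rfl (by omega))

theorem isZero_tateExt_iff (T : ChainComplex (ModuleCat.{v} R) ℤ) (N : ModuleCat.{v} R) :
    (∀ i, Limits.IsZero (tateExt T N i)) ↔ (homToModule T N).Acyclic := by
  constructor
  · intro h j
    rw [HomologicalComplex.exactAt_iff_isZero_homology]
    simpa [tateExt] using h (-j)
  · intro h i
    exact (HomologicalComplex.exactAt_iff_isZero_homology _ _).1 (h (-i))

theorem homToModule_d_eq_zero_iff (T : ChainComplex (ModuleCat.{v} R) ℤ) (N : ModuleCat.{v} R)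
    (n m : ℤ) (f : T.X (-n) →ₗ[R] N) :
    ((homToModule T N).d n m).hom f = (0 : T.X (-m) →ₗ[R] N) ↔ f ∘ₗ (T.d (-m) (-n)).hom = 0 := by
  change (-(n.negOnePow • (f ∘ₗ (T.d (-m) (-n)).hom)) : T.X (-m) →ₗ[R] N) = 0 ↔ _
  rw [neg_eq_zero]
  rcases Int.units_eq_one_or n.negOnePow with h | h <;> simp [h]

/-- The signs in the differential are units and do not affect exactness. Indices are those of `T`,
opposite to the degrees of the Hom complex. -/
theorem acyclic_homToModule_iff (T : ChainComplex (ModuleCat.{v} R) ℤ) (N : ModuleCat.{v} R) :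
    (homToModule T N).Acyclic ↔ ∀ i j k : ℤ, j + 1 = i → k + 1 = j → ∀ f : T.X j →ₗ[R] N,
      f ∘ₗ (T.d i j).hom = 0 → ∃ g : T.X k →ₗ[R] N, g ∘ₗ (T.d j k).hom = f := by
  rw [acyclic_iff]
  constructor
  · intro h i j k hi hk f hf
    obtain ⟨i, rfl⟩ : ∃ n, i = -n := ⟨-i, by simp⟩
    obtain ⟨j, rfl⟩ : ∃ n, j = -n := ⟨-j, by simp⟩
    obtain ⟨k, rfl⟩ : ∃ n, k = -n := ⟨-k, by simp⟩
    obtain ⟨g, hg⟩ := h k j i (by omega) (by omega) f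
      ((homToModule_d_eq_zero_iff T N j i f).2 hf)
    replace hg : (-(k.negOnePow • ((g : T.X (-k) →ₗ[R] N) ∘ₗ (T.d (-j) (-k)).hom)) :
      T.X (-j) →ₗ[R] N) = f := hg
    refine ⟨-(k.negOnePow • (g : T.X (-k) →ₗ[R] N)), ?_⟩
    rw [← hg]
    rfl
  · intro h i j k hi hk f hf
    obtain ⟨g, hg⟩ := h (-k) (-j) (-i) (by omega) (by omega) f
      ((homToModule_d_eq_zero_iff T N j k f).1 hf)
    refine ⟨(-(i.negOnePow • g) : T.X (-i) →ₗ[R] N), ?_⟩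
    change (-(i.negOnePow • ((-(i.negOnePow • g) : T.X (-i) →ₗ[R] N) ∘ₗ (T.d (-j) (-i)).hom)) :
      T.X (-j) →ₗ[R] N) = f
    rw [← hg]
    rcases Int.units_eq_one_or i.negOnePow with h | h <;> simp [h]

/-- Maps from a projective module into the cycles of an acyclic complex lift along the
differential. -/
theorem exists_lift_of_acyclic {A : ChainComplex (ModuleCat.{v} R) ℤ} (hA : A.Acyclic)
    {P : Type v} [AddCommGroup P] [Module R P] [Module.Projective R P] {i j k : ℤ}
    (hi : j + 1 = i) (hk : k + 1 = j) (f : P →ₗ[R] A.X j) (hf : (A.d j k).hom ∘ₗ f = 0) :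
    ∃ g : P →ₗ[R] A.X i, (A.d i j).hom ∘ₗ g = f := by
  obtain ⟨g, hg⟩ := Module.projective_lifting_property (A.d i j).hom.rangeRestrict
    (f.codRestrict (LinearMap.range (A.d i j).hom)
      fun x => (acyclic_iff A).1 hA i j k hi hk _ (LinearMap.congr_fun hf x))
    (LinearMap.surjective_rangeRestrict _)
  refine ⟨g, LinearMap.ext fun x => ?_⟩
  exact congrArg Subtype.val (LinearMap.congr_fun hg x)

/-- If `P` is projective and `I` is injective, then `Hom_R(P, I)` is injective. -/
theorem injective_hom (P I : Type v) [AddCommGroup P] [Module R P] [AddCommGroup I] [Module R I]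
    [Module.Projective R P] (hI : Module.Injective R I) : Module.Injective R (P →ₗ[R] I) where
  out X Y _ _ _ _ f hf g := by
    -- Hom-tensor adjunction: `P` is flat, so `f ⊗ P` stays injective and the uncurried `g` extends
    -- along it.
    obtain ⟨h, hh⟩ := hI.out (f.rTensor P) (Module.Flat.rTensor_preserves_injective_linearMap f hf)
      (TensorProduct.lift g)
    refine ⟨TensorProduct.curry h, fun x => LinearMap.ext fun p => ?_⟩
    simpa using hh (x ⊗ₜ p)

/-- Each degree is a product of modules `Hom(T_p, A_q)`, injective by `injective_hom`; extensions
are chosen factor by factor. -/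
theorem injective_pinchedHom {T A : ChainComplex (ModuleCat.{v} R) ℤ}
    (hT : ∀ i, Module.Projective R (T.X i)) (hA : ∀ i, Module.Injective R (A.X i)) (n : ℤ) :
    Module.Injective R ((pinchedHom T A).X n) where
  out X Y _ _ _ _ f hf g := by
    have (s : {s : ℤ × ℤ // PinchIndex n s.1 s.2}) :
        ∃ h : Y →ₗ[R] (T.X s.1.1 →ₗ[R] A.X s.1.2), ∀ x, h (f x) = LinearMap.proj (R := R)
          (φ := fun s : {s : ℤ × ℤ // PinchIndex n s.1 s.2} => T.X s.1.1 →ₗ[R] A.X s.1.2) s (g x) :=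
      haveI := hT s.1.1
      (injective_hom (T.X s.1.1) (A.X s.1.2) (hA _)).out f hf (LinearMap.proj (R := R)
        (φ := fun s : {s : ℤ × ℤ // PinchIndex n s.1 s.2} => T.X s.1.1 →ₗ[R] A.X s.1.2) s ∘ₗ g)
    choose h hh using this
    exact ⟨LinearMap.pi h, fun x => funext fun s => hh s x⟩

/-! ### Clearing components by boundaries -/

section

variable {T A : ChainComplex (ModuleCat.{v} R) ℤ}

theorem pinchedHom_d_hom {n m : ℤ} (h : m + 1 = n) :
    ((pinchedHom T A).d n m).hom = pinchedD T A n m := by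
  change (if m + 1 = n then ModuleCat.ofHom (pinchedD T A n m) else 0 :
    ModuleCat.of R (Pinched T A n) ⟶ ModuleCat.of R (Pinched T A m)).hom = _
  rw [if_pos h]
  rfl

theorem acyclic_pinchedHom_iff_exact :
    (pinchedHom T A).Acyclic ↔ ∀ i j k : ℤ, j + 1 = i → k + 1 = j → ∀ φ : Pinched T A j,
      pinchedD T A j k φ = 0 → ∃ ψ : Pinched T A i, pinchedD T A i j ψ = φ := by
  rw [acyclic_iff]
  refine forall_congr' fun i => forall_congr' fun j => forall_congr' fun k =>
    forall_congr' fun hi => forall_congr' fun hk => ?_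
  rw [pinchedHom_d_hom hi, pinchedHom_d_hom hk]
  rfl

namespace Pinched

theorem ext_comp {n : ℤ} {φ ψ : Pinched T A n}
    (h : ∀ p q, PinchIndex n p q → φ.comp p q = ψ.comp p q) : φ = ψ := by
  funext ⟨⟨p, q⟩, hs⟩
  simpa only [comp_eq _ hs] using h p q hs

@[simp]
theorem comp_zero {n : ℤ} (p q : ℤ) : (0 : Pinched T A n).comp p q = 0 := by
  simp [comp]

theorem comp_sub {n : ℤ} (φ ψ : Pinched T A n) (p q : ℤ) :
    Pinched.comp (φ - ψ) p q = φ.comp p q - ψ.comp p q := by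
  by_cases h : PinchIndex n p q <;> simp [comp, h]

/-- The element of the pinched Hom whose only nonzero component is `f : T_p → A_q`. -/
noncomputable def single {n p q : ℤ} (h : PinchIndex n p q) (f : T.X p →ₗ[R] A.X q) :
    Pinched T A n :=
  Pi.single (M := fun s : {s : ℤ × ℤ // PinchIndex n s.1 s.2} => T.X s.1.1 →ₗ[R] A.X s.1.2)
    ⟨(p, q), h⟩ f

@[simp]
theorem comp_single_same {n p q : ℤ} (h : PinchIndex n p q) (f : T.X p →ₗ[R] A.X q) :
    (single h f).comp p q = f := by
  rw [comp_eq _ h]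
  exact Pi.single_eq_same _ _

theorem comp_single_of_ne {n p q p' q' : ℤ} (h : PinchIndex n p q) (f : T.X p →ₗ[R] A.X q)
    (hp : p' ≠ p) : (single h f).comp p' q' = 0 := by
  by_cases h' : PinchIndex n p' q'
  · rw [comp_eq _ h']
    exact Pi.single_eq_of_ne (fun e => hp (congrArg (fun s => s.1.1) e)) _
  · exact comp_eq_zero _ h'

end Pinched

/-- The sign of `d^A` in the differential of the pinched Hom. -/
def pinchSign (n : ℤ) : ℤˣ := if 2 ≤ n then -1 else 1

/-- Away from degree 1 the two halves differ only in the sign of `d^A`, so one formula serves both.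
The free `p'` and `q'` allow indices such as `-n` or `2` without casts. -/
theorem pinchedD_comp {n m p q p' q' : ℤ} (hn : n ≠ 1) (h : PinchIndex m p q)
    (hp : p' = p - 1) (hq : q' = q + 1) (φ : Pinched T A n) :
    (pinchedD T A n m φ).comp p q = pinchSign n • ((A.d q' q).hom ∘ₗ φ.comp p q') -
        n.negOnePow • (φ.comp p' q ∘ₗ (T.d p p').hom) := by
  subst hp hq
  rw [pinchedD_comp_apply _ _ _ _ _ h, pinchedDComp, pinchSign]
  split_ifs <;> simp

theorem pinchedD_one_comp (φ : Pinched T A 1) : (pinchedD T A 1 0 φ).comp 0 0 =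
    (A.d 1 0).hom ∘ₗ φ.comp (-1) 1 ∘ₗ (T.d 0 (-1)).hom := by
  rw [pinchedD_comp_apply _ _ _ _ _ (by unfold PinchIndex; omega), pinchedDComp]
  simp

theorem pinchedD_zero_comp (φ : Pinched T A 0) : (pinchedD T A 0 (-1) φ).comp 0 (-1) =
    (A.d 0 (-1)).hom ∘ₗ φ.comp 0 0 := by
  rw [pinchedD_comp (p' := -1) (q' := 0) (by omega) (by unfold PinchIndex; omega) rfl rfl,
    φ.comp_eq_zero (p := -1) (by unfold PinchIndex; omega)]
  simp [pinchSign]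

/-- An element whose components at indices below `k` vanish and whose component at `k` is a
`d^A`-cycle can be modified by a boundary so that its component at `k` vanishes as well. -/
theorem exists_sub_pinchedD_comp_eq_zero [hT : ∀ i, Module.Projective R (T.X i)] (hA : A.Acyclic)
    {n l k q : ℤ} (hl : n + 1 = l) (h : PinchIndex n k q) (h' : PinchIndex l k (q + 1))
    (φ : Pinched T A n) (hφ : ∀ p < k, ∀ q, φ.comp p q = 0)
    (hd : (A.d q (q - 1)).hom ∘ₗ φ.comp k q = 0) :
    ∃ ψ : Pinched T A l, (∀ p ≠ k, ∀ q, ψ.comp p q = 0) ∧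
      ∀ p ≤ k, ∀ q, (φ - pinchedD T A l n ψ).comp p q = 0 := by
  -- Row `k` occurs in both degrees `n` and `l`, so both lie on the same side of the pinch.
  have hn : l ≠ 1 := by unfold PinchIndex at h h'; omega
  obtain ⟨g, hg⟩ := exists_lift_of_acyclic hA (i := q + 1) (k := q - 1) rfl (by omega)
    (φ.comp k q) hd
  -- The boundary of this element lives in rows `k` and `k + 1` only, so the rows below `k` are
  -- undisturbed.
  refine ⟨Pinched.single h' (pinchSign l • g), fun p hp q => Pinched.comp_single_of_ne h' _ hp,
    fun p hp q' => ?_⟩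
  by_cases hi : PinchIndex n p q'
  swap
  · exact Pinched.comp_eq_zero _ hi
  rw [Pinched.comp_sub, pinchedD_comp hn hi rfl rfl,
    Pinched.comp_single_of_ne (p' := p - 1) _ _ (by omega)]
  rcases hp.lt_or_eq with hp | rfl
  · rw [hφ p hp, Pinched.comp_single_of_ne _ _ hp.ne]
    simp
  · obtain rfl : q' = q := by unfold PinchIndex at h hi; omega
    rw [Pinched.comp_single_same, ← hg]
    rcases Int.units_eq_one_or (pinchSign l) with e | e <;> simp [e]

/-- If the components of `φ` below `a` and those of its boundary below `b` vanish, then `φ` can be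
modified by a boundary so that all its components below `b` vanish. -/
theorem exists_sub_pinchedD_comp_eq_zero_of_lt [hT : ∀ i, Module.Projective R (T.X i)]
    (hA : A.Acyclic) {n l m a b : ℤ} (hl : n + 1 = l) (hm : m + 1 = n) (hab : a ≤ b)
    (hI : ∀ k, a ≤ k → k < b →
      ∃ q, PinchIndex n k q ∧ PinchIndex l k (q + 1) ∧ PinchIndex m k (q - 1))
    (φ : Pinched T A n) (hφ : ∀ p < a, ∀ q, φ.comp p q = 0)
    (hd : ∀ p < b, ∀ q, (pinchedD T A n m φ).comp p q = 0) :
    ∃ ψ : Pinched T A l, (∀ p < a, ∀ q, ψ.comp p q = 0) ∧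
      ∀ p < b, ∀ q, (φ - pinchedD T A l n ψ).comp p q = 0 := by
  induction b, hab using Int.leInduction with
  | base => exact ⟨0, by simp, by simpa using hφ⟩
  | succ b hab ih =>
    obtain ⟨ψ, hψa, hψ⟩ := ih (fun k h1 h2 => hI k h1 (by omega)) (fun p hp => hd p (by omega))
    obtain ⟨q, hq, hq', hq''⟩ := hI b hab (by omega)
    -- Row `b - 1` is already cleared, so the boundary at `(b, q - 1)` consists of the `d^A` term
    -- alone.
    have hc : (A.d q (q - 1)).hom ∘ₗ (φ - pinchedD T A l n ψ).comp b q = 0 := by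
      have h1 : (pinchedD T A n m (φ - pinchedD T A l n ψ)).comp b (q - 1) = 0 := by
        rw [map_sub, pinchedD_comp_pinchedD T A l n m hl hm, sub_zero]
        exact hd b (by omega) _
      rw [pinchedD_comp (by unfold PinchIndex at hq hq''; omega) hq'' rfl (sub_add_cancel q 1).symm,
        hψ (b - 1) (by omega)] at h1
      rcases Int.units_eq_one_or (pinchSign n) with e | e <;> simpa [e] using h1
    obtain ⟨χ, hχ, hχ'⟩ := exists_sub_pinchedD_comp_eq_zero hA hl hq hq' _ hψ hc
    refine ⟨ψ + χ, fun p hp q => ?_, fun p hp q => ?_⟩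
    · rw [Pinched.comp_add, hψa p hp, hχ p (by omega), add_zero]
    · rw [map_add, ← sub_sub]
      exact hχ' p (by omega) q

/-- In nonpositive degrees every element whose boundary has no components below `b` can be modified
by a boundary so that all its components below `b` vanish. -/
theorem exists_sub_pinchedD_of_neg [hT : ∀ i, Module.Projective R (T.X i)]
    (hA : A.Acyclic) {n l m b : ℤ} (hl : n + 1 = l) (hm : m + 1 = n) (hn : n ≤ 0) (hb : b ≤ -n)
    (φ : Pinched T A n) (hd : ∀ p < b, ∀ q, (pinchedD T A n m φ).comp p q = 0) :
    ∃ ψ : Pinched T A l, ∀ p < b, ∀ q, (φ - pinchedD T A l n ψ).comp p q = 0 := by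
  have hφ : ∀ p < 0, ∀ q, φ.comp p q = 0 := fun p hp q =>
    φ.comp_eq_zero (by unfold PinchIndex; omega)
  rcases le_or_gt b 0 with h0 | h0
  · exact ⟨0, fun p hp q => by simpa using hφ p (by omega) q⟩
  · obtain ⟨ψ, -, hψ⟩ := exists_sub_pinchedD_comp_eq_zero_of_lt hA hl hm h0.le
      (fun k h1 h2 => ⟨k + n, by unfold PinchIndex; omega⟩) φ hφ hd
    exact ⟨ψ, hψ⟩

/-- In positive degrees a cycle whose lowest component is a `d^A`-cycle is a boundary. -/
theorem exists_pinchedD_eq_of_pos [hT : ∀ i, Module.Projective R (T.X i)]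
    (hA : A.Acyclic) {n l m : ℤ} (hl : n + 1 = l) (hm : m + 1 = n) (hn : 1 ≤ n)
    (φ : Pinched T A n) (hφ : (A.d 1 0).hom ∘ₗ φ.comp (-n) 1 = 0)
    (hd : pinchedD T A n m φ = 0) :
    ∃ ψ : Pinched T A l, (∀ q, ψ.comp (-l) q = 0) ∧ pinchedD T A l n ψ = φ := by
  -- On the lowest row `d_1` would land in `A_0`, outside the positive half, so being a cycle says
  -- nothing there and `hφ` must supply it.
  obtain ⟨ψ, hψ, hψ'⟩ := exists_sub_pinchedD_comp_eq_zero hA (k := -n) (q := 1) hl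
    (by unfold PinchIndex; omega) (by unfold PinchIndex; omega) φ
    (fun p hp q => φ.comp_eq_zero (by unfold PinchIndex; omega)) (by simpa using hφ)
  have hd' : pinchedD T A n m (φ - pinchedD T A l n ψ) = 0 := by
    rw [map_sub, pinchedD_comp_pinchedD T A l n m hl hm, hd, sub_zero]
  -- The rows from `-n + 1` to `-1` follow. Neither correction touches row `-l`.
  obtain ⟨χ, hχ, hχ'⟩ := exists_sub_pinchedD_comp_eq_zero_of_lt hA (a := -n + 1) (b := 0) hl hm
    (by omega) (fun k h1 h2 => ⟨k + n + 1, by unfold PinchIndex; omega⟩)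
    (φ - pinchedD T A l n ψ) (fun p hp q => hψ' p (by omega) q) (fun p hp q => by simp [hd'])
  refine ⟨ψ + χ, fun q => ?_, ?_⟩
  · rw [Pinched.comp_add, hψ _ (by omega), hχ _ (by omega), add_zero]
  · rw [map_add, eq_comm, ← sub_eq_zero, ← sub_sub]
    refine Pinched.ext_comp fun p q hpq => ?_
    rw [hχ' p (by unfold PinchIndex at hpq; omega), Pinched.comp_zero]

end

/-! ### Comparison of the pinched Hom with `Hom(T, L)` -/

section

variable {T A : ChainComplex (ModuleCat.{v} R) ℤ} {L : ModuleCat.{v} R}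

theorem exists_factor_ker {P : Type v} [AddCommGroup P] [Module R P] {ι : L →ₗ[R] A.X 0}
    (hι : Function.Injective ι) (hr : LinearMap.range ι = LinearMap.ker (A.d 0 (-1)).hom)
    (f : P →ₗ[R] A.X 0) (hf : (A.d 0 (-1)).hom ∘ₗ f = 0) : ∃ g : P →ₗ[R] L, ι ∘ₗ g = f := by
  refine ⟨(LinearEquiv.ofInjective ι hι).symm ∘ₗ f.codRestrict (LinearMap.range ι) fun x => ?_, ?_⟩
  · rw [hr]
    exact LinearMap.congr_fun hf x
  · refine LinearMap.ext fun x => ?_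
    exact congrArg Subtype.val ((LinearEquiv.ofInjective ι hι).apply_symm_apply _)

theorem d_comp_d_hom (K : ChainComplex (ModuleCat.{v} R) ℤ) (i j k : ℤ) :
    (K.d j k).hom ∘ₗ (K.d i j).hom = 0 :=
  LinearMap.ext fun x => dd_apply K i j k x

/-- The splice of `A` at `L`: exactness at `A_0` makes the corestriction of `d_1` onto `L`
surjective. -/
theorem exists_surjection_of_acyclic (hA : A.Acyclic) {ι : L →ₗ[R] A.X 0}
    (hι : Function.Injective ι) (hr : LinearMap.range ι = LinearMap.ker (A.d 0 (-1)).hom) :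
    ∃ π : A.X 1 →ₗ[R] L, Function.Surjective π ∧ ι ∘ₗ π = (A.d 1 0).hom := by
  obtain ⟨π, hπ⟩ := exists_factor_ker hι hr (A.d 1 0).hom (d_comp_d_hom A 1 0 (-1))
  refine ⟨π, fun x => ?_, hπ⟩
  obtain ⟨y, hy⟩ := (acyclic_iff A).1 hA 1 0 (-1) (by omega) (by omega) (ι x)
    (hr.le (LinearMap.mem_range_self ι x))
  exact ⟨y, hι (by rw [← hy, ← hπ]; rfl)⟩

theorem comp_eq_zero_of_injective {P Q : Type v} [AddCommGroup P] [Module R P] [AddCommGroup Q]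
    [Module R Q] {ι : L →ₗ[R] Q} (hι : Function.Injective ι) {f : P →ₗ[R] L}
    (h : ι ∘ₗ f = 0) : f = 0 :=
  LinearMap.ext fun x => hι (by simpa using LinearMap.congr_fun h x)

/-- If `Hom_R(T, L)` is acyclic, then the pinched Hom is exact in nonpositive degrees. -/
theorem exists_pinchedD_eq_of_nonpos [hT : ∀ i, Module.Projective R (T.X i)] (hA : A.Acyclic)
    {ι : L →ₗ[R] A.X 0} (hι : Function.Injective ι)
    (hr : LinearMap.range ι = LinearMap.ker (A.d 0 (-1)).hom) (hL : (homToModule T L).Acyclic)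
    {n l m : ℤ} (hl : n + 1 = l) (hm : m + 1 = n) (hn : n ≤ 0) (φ : Pinched T A n)
    (hφ : pinchedD T A n m φ = 0) : ∃ ψ : Pinched T A l, pinchedD T A l n ψ = φ := by
  -- Only the top component `T_{-n} → A_0` survives; it factors through `L` as a cocycle `θ`.
  obtain ⟨χ, hχ⟩ := exists_sub_pinchedD_of_neg hA (b := -n) hl hm hn le_rfl φ (by simp [hφ])
  suffices ∃ ψ : Pinched T A l, pinchedD T A l n ψ = φ - pinchedD T A l n χ by
    obtain ⟨ψ, hψ⟩ := this
    exact ⟨ψ + χ, by rw [map_add, hψ, sub_add_cancel]⟩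
  have hd : pinchedD T A n m (φ - pinchedD T A l n χ) = 0 := by
    rw [map_sub, pinchedD_comp_pinchedD T A l n m hl hm, hφ, sub_zero]
  generalize φ - pinchedD T A l n χ = φ' at hχ hd
  have h1 : (A.d 0 (-1)).hom ∘ₗ φ'.comp (-n) 0 = 0 := by
    have := congrArg (fun φ => φ.comp (-n) (-1)) hd
    simp only [Pinched.comp_zero] at this
    rw [pinchedD_comp (p' := -l) (q' := 0) (by omega) (by unfold PinchIndex; omega) (by omega) rfl,
      hχ (-l) (by omega)] at this
    rcases Int.units_eq_one_or (pinchSign n) with e | e <;> simpa [e] using this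
  have h2 : φ'.comp (-n) 0 ∘ₗ (T.d (-m) (-n)).hom = 0 := by
    have := congrArg (fun φ => φ.comp (-m) 0) hd
    simp only [Pinched.comp_zero] at this
    rw [pinchedD_comp (p' := -n) (q' := 1) (by omega) (by unfold PinchIndex; omega) (by omega) rfl,
      φ'.comp_eq_zero (p := -m) (by unfold PinchIndex; omega)] at this
    rcases Int.units_eq_one_or n.negOnePow with e | e <;> simpa [e] using this
  obtain ⟨θ, hθ⟩ := exists_factor_ker hι hr _ h1
  rw [← hθ, LinearMap.comp_assoc] at h2
  obtain ⟨η, hη⟩ := (acyclic_homToModule_iff T L).1 hL (-m) (-n) (-l) (by omega) (by omega) θ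
    (comp_eq_zero_of_injective hι h2)
  rcases hn.lt_or_eq with hn | rfl
  · have hs : PinchIndex l (-l) 0 := by unfold PinchIndex; omega
    -- The sign cancels the one in front of the `d^T` term; the `d^A` term vanishes since `ι` lands
    -- in cycles.
    refine ⟨Pinched.single hs (-(l.negOnePow • (ι ∘ₗ η))), Pinched.ext_comp fun p q hpq => ?_⟩
    rw [pinchedD_comp (by omega) hpq rfl rfl]
    have hpq' := hpq
    unfold PinchIndex at hpq'
    rcases lt_trichotomy p (-n) with h | rfl | h
    · rw [hχ p h, Pinched.comp_single_of_ne (p' := p - 1) _ _ (by omega)]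
      by_cases hp : p = -l
      · obtain rfl : q = -1 := by omega
        subst hp
        have hιd : (A.d 0 (-1)).hom ∘ₗ ι = 0 :=
          LinearMap.ext fun x => hr.le (LinearMap.mem_range_self ι x)
        rw [show (-1 : ℤ) + 1 = 0 from rfl, Pinched.comp_single_same]
        rcases Int.units_eq_one_or l.negOnePow with e | e <;>
          simp [e, ← LinearMap.comp_assoc, hιd]
      · rw [Pinched.comp_single_of_ne _ _ hp]
        simp
    · obtain rfl : q = 0 := by omega
      rw [Pinched.comp_single_of_ne (p' := -n) _ _ (by omega)]
      obtain rfl : l = n + 1 := by omega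
      rw [← hθ, ← hη]
      have : -n - 1 = -(n + 1) := by omega
      rw [this, Pinched.comp_single_same]
      rcases Int.units_eq_one_or (n + 1).negOnePow with e | e <;> simp [e, LinearMap.comp_assoc]
    · omega
  · obtain rfl : l = 1 := by omega
    obtain ⟨π, hπ, hπd⟩ := exists_surjection_of_acyclic hA hι hr
    -- A preimage in degree 1 must take values in `A_1`, so `η : T_{-1} → L` is lifted along `π`.
    obtain ⟨g, hg⟩ := Module.projective_lifting_property π η hπ
    have hs : PinchIndex 1 (-1) 1 := by unfold PinchIndex; omega
    refine ⟨Pinched.single hs g, Pinched.ext_comp fun p q hpq => ?_⟩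
    obtain ⟨rfl, rfl⟩ : p = 0 ∧ q = 0 := by unfold PinchIndex at hpq; omega
    rw [pinchedD_one_comp, Pinched.comp_single_same, ← hπd, LinearMap.comp_assoc,
      ← LinearMap.comp_assoc _ _ π, hg]
    exact (congrArg (ι ∘ₗ ·) hη).trans hθ

/-- If `Hom_R(T, L)` is acyclic, then the pinched Hom is exact in positive degrees. -/
theorem exists_pinchedD_eq_of_acyclic_homToModule [hT : ∀ i, Module.Projective R (T.X i)]
    (hA : A.Acyclic) {ι : L →ₗ[R] A.X 0} (hι : Function.Injective ι)
    (hr : LinearMap.range ι = LinearMap.ker (A.d 0 (-1)).hom) (hL : (homToModule T L).Acyclic)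
    {n l m : ℤ} (hl : n + 1 = l) (hm : m + 1 = n) (hn : 1 ≤ n) (φ : Pinched T A n)
    (hφ : pinchedD T A n m φ = 0) : ∃ ψ : Pinched T A l, pinchedD T A l n ψ = φ := by
  obtain ⟨π, hπ, hπd⟩ := exists_surjection_of_acyclic hA hι hr
  -- This makes `π φ_{-n}` a cocycle. For `n > 1`, composing the cycle condition at `(-m, 1)` with
  -- `d_1` kills its `d_2` term.
  have h1 : (A.d 1 0).hom ∘ₗ φ.comp (-n) 1 ∘ₗ (T.d (-m) (-n)).hom = 0 := by
    by_cases h : n = 1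
    · subst h
      obtain rfl : m = 0 := by omega
      simpa [hφ] using (pinchedD_one_comp φ).symm
    · have := congrArg (fun φ => φ.comp (-m) 1) hφ
      simp only [Pinched.comp_zero] at this
      rw [pinchedD_comp (p' := -n) (q' := 2) h (by unfold PinchIndex; omega) (by omega) rfl]
        at this
      replace this := congrArg ((A.d 1 0).hom ∘ₗ ·) this
      rcases Int.units_eq_one_or (pinchSign n) with e | e <;>
      rcases Int.units_eq_one_or n.negOnePow with e' | e' <;>
        simpa [e, e', LinearMap.comp_sub, LinearMap.comp_add, ← LinearMap.comp_assoc, d_comp_d_hom]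
          using this
  rw [← hπd, LinearMap.comp_assoc] at h1
  obtain ⟨η, hη⟩ := (acyclic_homToModule_iff T L).1 hL (-m) (-n) (-l) (by omega) (by omega)
    (π ∘ₗ φ.comp (-n) 1) (comp_eq_zero_of_injective hι h1)
  obtain ⟨g, hg⟩ := Module.projective_lifting_property π η hπ
  have hs : PinchIndex l (-l) 1 := by unfold PinchIndex; omega
  -- The boundary of `χ` agrees with `φ` on row `-n` after applying `π`, so the difference satisfies
  -- the hypothesis of `exists_pinchedD_eq_of_pos`.
  set χ : Pinched T A l := Pinched.single hs (-(l.negOnePow • g)) with hχ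
  have h2 : (A.d 1 0).hom ∘ₗ (φ - pinchedD T A l n χ).comp (-n) 1 = 0 := by
    rw [Pinched.comp_sub, pinchedD_comp (p' := -l) (q' := 2) (by omega) (by unfold PinchIndex; omega)
      (by omega) rfl, hχ, Pinched.comp_single_same, Pinched.comp_single_of_ne _ _ (by omega),
      LinearMap.comp_sub, ← hπd, LinearMap.comp_assoc, ← hη, ← hg]
    rcases Int.units_eq_one_or l.negOnePow with e | e <;>
      simp [e, LinearMap.comp_assoc]
  obtain ⟨ψ, -, hψ⟩ := exists_pinchedD_eq_of_pos hA hl hm hn _ h2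
    (by rw [map_sub, pinchedD_comp_pinchedD T A l n m hl hm, hφ, sub_zero])
  exact ⟨ψ + χ, by rw [map_add, hψ, sub_add_cancel]⟩

/-- If the pinched Hom is acyclic, then `Hom_R(T, L)` is exact in nonpositive degrees. -/
theorem exists_comp_d_eq_of_nonpos [hT : ∀ i, Module.Projective R (T.X i)] (hA : A.Acyclic)
    {ι : L →ₗ[R] A.X 0} (hι : Function.Injective ι)
    (hr : LinearMap.range ι = LinearMap.ker (A.d 0 (-1)).hom) (hP : (pinchedHom T A).Acyclic)
    {n l m : ℤ} (hl : n + 1 = l) (hm : m + 1 = n) (hn : n ≤ 0) (θ : T.X (-n) →ₗ[R] L)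
    (hθ : θ ∘ₗ (T.d (-m) (-n)).hom = 0) :
    ∃ η : T.X (-l) →ₗ[R] L, η ∘ₗ (T.d (-n) (-l)).hom = θ := by
  have hιd : (A.d 0 (-1)).hom ∘ₗ ι = 0 :=
    LinearMap.ext fun x => hr.le (LinearMap.mem_range_self ι x)
  have hs : PinchIndex n (-n) 0 := by unfold PinchIndex; omega
  set φ : Pinched T A n := Pinched.single hs (ι ∘ₗ θ) with hφ
  have hd : pinchedD T A n m φ = 0 := by
    refine Pinched.ext_comp fun p q hpq => ?_
    have hpq' := hpq
    unfold PinchIndex at hpq'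
    rw [pinchedD_comp (by omega) hpq rfl rfl, Pinched.comp_zero]
    by_cases h1 : p = -n
    · obtain rfl : q = -1 := by omega
      subst h1
      rw [Pinched.comp_single_of_ne (p' := -n - 1) _ _ (by omega), show (-1 : ℤ) + 1 = 0 from rfl,
        hφ, Pinched.comp_single_same, ← LinearMap.comp_assoc, hιd]
      simp
    by_cases h2 : p = -m
    · obtain rfl : q = 0 := by omega
      subst h2
      obtain rfl : n = m + 1 := by omega
      have : -m - 1 = -(m + 1) := by omega
      rw [Pinched.comp_single_of_ne (p' := -m) _ _ (by omega), this, hφ, Pinched.comp_single_same,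
        LinearMap.comp_assoc, hθ]
      simp
    · rw [Pinched.comp_single_of_ne (p' := p) _ _ h1,
        Pinched.comp_single_of_ne (p' := p - 1) _ _ (by omega)]
      simp
  obtain ⟨ψ, hψ⟩ := acyclic_pinchedHom_iff_exact.1 hP l n m hl hm φ hd
  rcases hn.lt_or_eq with hn | rfl
  -- The boundary `φ` of `ψ` lives in row `-n > -l`, so `ψ` can be reduced to its top component,
  -- which then factors through `L`.
  · obtain ⟨χ, hχ⟩ := exists_sub_pinchedD_of_neg hA (l := l + 1) (b := -l) rfl hl (by omega) le_rfl
      ψ (fun p hp q => by rw [hψ, hφ, Pinched.comp_single_of_ne _ _ (by omega)])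
    have hψ' : pinchedD T A l n (ψ - pinchedD T A (l + 1) l χ) = φ := by
      rw [map_sub, pinchedD_comp_pinchedD T A _ l n rfl hl, hψ, sub_zero]
    generalize ψ - pinchedD T A (l + 1) l χ = ψ' at hχ hψ'
    have h1 : (A.d 0 (-1)).hom ∘ₗ ψ'.comp (-l) 0 = 0 := by
      have := congrArg (fun φ => φ.comp (-l) (-1)) hψ'
      simp only [hφ, Pinched.comp_single_of_ne (p := -n) (p' := -l) hs _ (by omega)] at this
      rw [pinchedD_comp (p' := -l - 1) (q' := 0) (by omega) (by unfold PinchIndex; omega)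
        rfl rfl, hχ (-l - 1) (by omega)] at this
      rcases Int.units_eq_one_or (pinchSign l) with e | e <;> simpa [e] using this
    obtain ⟨η, hη⟩ := exists_factor_ker hι hr _ h1
    have h2 : ι ∘ₗ (-(l.negOnePow • (η ∘ₗ (T.d (-n) (-l)).hom)) - θ) = 0 := by
      have := congrArg (fun φ => φ.comp (-n) 0) hψ'
      simp only [hφ, Pinched.comp_single_same] at this
      rw [pinchedD_comp (p' := -l) (q' := 1) (by omega) hs (by omega) rfl,
        ψ'.comp_eq_zero (p := -n) (by unfold PinchIndex; omega), ← hη] at this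
      rw [LinearMap.comp_sub, ← this]
      rcases Int.units_eq_one_or l.negOnePow with e | e <;> simp [e, LinearMap.comp_assoc]
    refine ⟨-(l.negOnePow • η), ?_⟩
    rw [← sub_eq_zero.1 (comp_eq_zero_of_injective hι h2)]
    rcases Int.units_eq_one_or l.negOnePow with e | e <;> simp [e]
  · obtain rfl : l = 1 := by omega
    obtain rfl : m = -1 := by omega
    obtain ⟨π, hπ, hπd⟩ := exists_surjection_of_acyclic hA hι hr
    refine ⟨π ∘ₗ ψ.comp (-1) 1, sub_eq_zero.1 (comp_eq_zero_of_injective hι ?_)⟩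
    have h1 := pinchedD_one_comp ψ
    rw [hψ] at h1
    have h2 : φ.comp 0 0 = ι ∘ₗ θ := Pinched.comp_single_same hs _
    rw [LinearMap.comp_sub, ← h2, h1, ← hπd]
    exact sub_self _

/-- If the pinched Hom is acyclic, then `Hom_R(T, L)` is exact in positive degrees. -/
theorem exists_comp_d_eq_of_pos [hT : ∀ i, Module.Projective R (T.X i)] (hA : A.Acyclic)
    {ι : L →ₗ[R] A.X 0} (hι : Function.Injective ι)
    (hr : LinearMap.range ι = LinearMap.ker (A.d 0 (-1)).hom) (hP : (pinchedHom T A).Acyclic)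
    {n l m : ℤ} (hl : n + 1 = l) (hm : m + 1 = n) (hn : 1 ≤ n) (θ : T.X (-n) →ₗ[R] L)
    (hθ : θ ∘ₗ (T.d (-m) (-n)).hom = 0) :
    ∃ η : T.X (-l) →ₗ[R] L, η ∘ₗ (T.d (-n) (-l)).hom = θ := by
  obtain ⟨π, hπ, hπd⟩ := exists_surjection_of_acyclic hA hι hr
  obtain ⟨f, hf⟩ := Module.projective_lifting_property π θ hπ
  have hs : PinchIndex n (-n) 1 := by unfold PinchIndex; omega
  have hfd : (A.d 1 0).hom ∘ₗ f ∘ₗ (T.d (-m) (-n)).hom = 0 := by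
    rw [← hπd, LinearMap.comp_assoc, ← LinearMap.comp_assoc _ _ π, hf, hθ, LinearMap.comp_zero]
  -- The lift `f` is completed to a cycle. For `n > 1` the boundary of `single hs f` is also the
  -- boundary of some `ψ` with no component on row `-n`; subtracting `ψ` leaves `f` in place.
  obtain ⟨φ, hφ, hd⟩ : ∃ φ : Pinched T A n, φ.comp (-n) 1 = f ∧ pinchedD T A n m φ = 0 := by
    by_cases h : n = 1
    · subst h
      obtain rfl : m = 0 := by omega
      refine ⟨Pinched.single hs f, Pinched.comp_single_same _ _,
        Pinched.ext_comp fun p q hpq => ?_⟩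
      obtain ⟨rfl, rfl⟩ : p = 0 ∧ q = 0 := by unfold PinchIndex at hpq; omega
      rw [pinchedD_one_comp, Pinched.comp_single_same, Pinched.comp_zero]
      exact hfd
    · obtain ⟨ψ, hψ, hψ'⟩ := exists_pinchedD_eq_of_pos hA hm (m := m - 1) (by omega) (by omega)
        (pinchedD T A n m (Pinched.single hs f)) (by
          rw [pinchedD_comp (p' := -n) (q' := 2) h (by unfold PinchIndex; omega) (by omega) rfl,
            Pinched.comp_single_of_ne _ _ (by omega), Pinched.comp_single_same]
          rcases Int.units_eq_one_or n.negOnePow with e | e <;> simp [e, hfd])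
        (pinchedD_comp_pinchedD T A n m _ hm (by omega) _)
      exact ⟨Pinched.single hs f - ψ, by rw [Pinched.comp_sub, hψ, Pinched.comp_single_same,
        sub_zero], by rw [map_sub, hψ', sub_self]⟩
  obtain ⟨ψ, hψ⟩ := acyclic_pinchedHom_iff_exact.1 hP l n m hl hm φ hd
  refine ⟨-(l.negOnePow • (π ∘ₗ ψ.comp (-l) 1)), sub_eq_zero.1 (comp_eq_zero_of_injective hι ?_)⟩
  rw [← hf, ← hφ, ← hψ, pinchedD_comp (p' := -l) (q' := 2) (by omega) hs (by omega) rfl,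
    LinearMap.comp_sub, LinearMap.comp_sub, LinearMap.comp_sub]
  -- The `d^A` term disappears because `ι π d_2 = d_1 d_2 = 0`.
  have : ι ∘ₗ π ∘ₗ (pinchSign l • ((A.d 2 1).hom ∘ₗ ψ.comp (-n) 2)) = 0 := by
    rw [← LinearMap.comp_assoc _ _ ι, hπd]
    rcases Int.units_eq_one_or (pinchSign l) with e | e <;>
      simp [e, ← LinearMap.comp_assoc, d_comp_d_hom]
  rw [this]
  rcases Int.units_eq_one_or l.negOnePow with e | e <;> simp [e, LinearMap.comp_assoc]

/-- For a complex `T` of projective modules and an acyclic complex `A` with module of cycles `L` in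
degree `0`, the pinched Hom of `T` and `A` is acyclic if and only if `Hom_R(T, L)` is. -/
theorem acyclic_pinchedHom_iff (hT : ∀ i, Module.Projective R (T.X i)) (hA : A.Acyclic)
    {ι : L →ₗ[R] A.X 0} (hι : Function.Injective ι)
    (hr : LinearMap.range ι = LinearMap.ker (A.d 0 (-1)).hom) :
    (pinchedHom T A).Acyclic ↔ (homToModule T L).Acyclic := by
  constructor
  · intro hP
    rw [acyclic_homToModule_iff]
    intro i j k hi hk f hf
    obtain ⟨i, rfl⟩ : ∃ n, i = -n := ⟨-i, by simp⟩
    obtain ⟨j, rfl⟩ : ∃ n, j = -n := ⟨-j, by simp⟩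
    obtain ⟨k, rfl⟩ : ∃ n, k = -n := ⟨-k, by simp⟩
    rcases le_or_gt j 0 with hj | hj
    · exact exists_comp_d_eq_of_nonpos hA hι hr hP (by omega) (by omega) hj f hf
    · exact exists_comp_d_eq_of_pos hA hι hr hP (by omega) (by omega) hj f hf
  · intro hL
    rw [acyclic_pinchedHom_iff_exact]
    intro i j k hi hk φ hφ
    rcases le_or_gt j 0 with hj | hj
    · exact exists_pinchedD_eq_of_nonpos hA hι hr hL hi hk hj φ hφ
    · exact exists_pinchedD_eq_of_acyclic_homToModule hA hι hr hL hi hk hj φ hφ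

end

/-! ### Interchanging arguments, and the cycles in degree 0 -/

section

variable (T U : ChainComplex (ModuleCat.{v} R) ℤ) (J : ModuleCat.{v} R)

/-- Interchange of arguments `Hom_R(J, Hom^⋈(T, U)) ≃ Hom^⋈(T, Hom_R(J, U))` in degree `n`. -/
def pinchedFlip (n : ℤ) : (J →ₗ[R] Pinched T U n) ≃ Pinched T (homFromModule J U) n where
  toFun h s := (LinearMap.proj (R := R)
    (φ := fun s : {s : ℤ × ℤ // PinchIndex n s.1 s.2} => T.X s.1.1 →ₗ[R] U.X s.1.2) s ∘ₗ h).flip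
  invFun φ := LinearMap.pi fun s => (φ s : T.X s.1.1 →ₗ[R] J →ₗ[R] U.X s.1.2).flip
  left_inv _ := rfl
  right_inv _ := rfl

variable {T U J}

/-- Evaluation at `x`, as a map from a component of the complex `Hom_R(J, U)` to that of `U`. -/
def evalHom (x : J) (q : ℤ) : (homFromModule J U).X q →ₗ[R] U.X q :=
  (LinearMap.applyₗ x : (J →ₗ[R] U.X q) →ₗ[R] U.X q)

theorem evalHom_comp_ext {P : Type v} [AddCommGroup P] [Module R P] {q : ℤ}
    {f g : P →ₗ[R] (homFromModule J U).X q} (h : ∀ x : J, evalHom x q ∘ₗ f = evalHom x q ∘ₗ g) :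
    f = g :=
  LinearMap.ext fun t => LinearMap.ext (M := J) (M₃ := U.X q) fun x => LinearMap.congr_fun (h x) t

theorem evalHom_comp_d (x : J) (n m : ℤ) :
    evalHom x m ∘ₗ ((homFromModule J U).d n m).hom = (U.d n m).hom ∘ₗ evalHom x n :=
  rfl

theorem evalHom_comp_pinchedFlip {n : ℤ} (h : J →ₗ[R] Pinched T U n) (x : J) (p q : ℤ) :
    evalHom x q ∘ₗ (pinchedFlip T U J n h).comp p q = (h x).comp p q := by
  by_cases hs : PinchIndex n p q
  · rw [Pinched.comp_eq _ hs, Pinched.comp_eq _ hs]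
    rfl
  · rw [Pinched.comp_eq_zero _ hs, Pinched.comp_eq_zero _ hs, LinearMap.comp_zero]

/-- The differentials compose with `d^U` on the left and `d^T` on the right, and both operations
commute with evaluation at a point of `J`. -/
theorem pinchedFlip_pinchedD {n m : ℤ} (h : J →ₗ[R] Pinched T U n) :
    pinchedFlip T U J m (pinchedD T U n m ∘ₗ h) =
      pinchedD T (homFromModule J U) n m (pinchedFlip T U J n h) := by
  refine Pinched.ext_comp fun p q hpq => evalHom_comp_ext fun x => ?_
  rw [evalHom_comp_pinchedFlip, LinearMap.comp_apply, pinchedD_comp_apply _ _ _ _ _ hpq,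
    pinchedD_comp_apply _ _ _ _ _ hpq, pinchedDComp, pinchedDComp]
  have h1 (i p : ℤ) : evalHom x q ∘ₗ (((homFromModule J U).d i q).hom ∘ₗ
      (pinchedFlip T U J n h).comp p i) = (U.d i q).hom ∘ₗ (h x).comp p i := by
    rw [← LinearMap.comp_assoc, evalHom_comp_d, LinearMap.comp_assoc, evalHom_comp_pinchedFlip]
  have h2 : evalHom x q ∘ₗ ((pinchedFlip T U J n h).comp (p - 1) q ∘ₗ (T.d p (p - 1)).hom) =
      (h x).comp (p - 1) q ∘ₗ (T.d p (p - 1)).hom := by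
    rw [← LinearMap.comp_assoc, evalHom_comp_pinchedFlip]
  split_ifs
  · rcases Int.units_eq_one_or n.negOnePow with e | e <;>
      simp only [e, one_smul, Units.neg_smul, LinearMap.comp_sub, LinearMap.comp_neg, h1, h2]
  · exact (congrArg (· ∘ₗ (T.d p (-1)).hom) (h1 1 (-1))).symm
  · rcases Int.units_eq_one_or n.negOnePow with e | e <;>
      simp only [e, one_smul, Units.neg_smul, LinearMap.comp_sub, LinearMap.comp_neg, h1, h2]

/-- The flips are bijections compatible with the differentials, so cycles and boundaries correspond.
-/
theorem acyclic_homFromModule_pinchedHom_iff :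
    (homFromModule J (pinchedHom T U)).Acyclic ↔ (pinchedHom T (homFromModule J U)).Acyclic := by
  have hd {n m : ℤ} (h : m + 1 = n) (f : J →ₗ[R] Pinched T U n) :
      ((homFromModule J (pinchedHom T U)).d n m).hom f = pinchedD T U n m ∘ₗ f := by
    rw [← pinchedHom_d_hom h]
    rfl
  have hz {n m : ℤ} (f : J →ₗ[R] Pinched T U n) : pinchedD T U n m ∘ₗ f = 0 ↔
      pinchedD T (homFromModule J U) n m (pinchedFlip T U J n f) = 0 := by
    rw [← pinchedFlip_pinchedD, ← (pinchedFlip T U J m).apply_eq_iff_eq]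
    rfl
  rw [acyclic_iff, acyclic_pinchedHom_iff_exact]
  refine forall_congr' fun i => forall_congr' fun j => forall_congr' fun k =>
    forall_congr' fun hi => forall_congr' fun hk => ?_
  constructor
  · intro h φ hφ
    obtain ⟨f, rfl⟩ := (pinchedFlip T U J j).surjective φ
    obtain ⟨g, hg⟩ := h f ((hd hk f).trans ((hz f).2 hφ))
    refine ⟨pinchedFlip T U J i g, ?_⟩
    exact (pinchedFlip_pinchedD (J := J) g).symm.trans (congrArg _ ((hd hi g).symm.trans hg))
  · intro h f hf
    obtain ⟨ψ, hψ⟩ := h (pinchedFlip T U J j f) ((hz f).1 ((hd hk f).symm.trans hf))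
    obtain ⟨g, rfl⟩ := (pinchedFlip T U J i).surjective ψ
    rw [← pinchedFlip_pinchedD] at hψ
    exact ⟨g, (hd hi g).trans ((pinchedFlip T U J j).injective hψ)⟩

/-- The cycles of the pinched Hom in degree `0` are the maps from the cokernel of `T_1 → T_0` to
the kernel of `U_0 → U_{-1}`. -/
theorem nonempty_ker_pinchedHom_equiv {M N : ModuleCat.{v} R}
    (eM : (T.X 0 ⧸ LinearMap.range (T.d 1 0).hom) ≃ₗ[R] M)
    (eN : LinearMap.ker (U.d 0 (-1)).hom ≃ₗ[R] N) :
    Nonempty (LinearMap.ker ((pinchedHom T U).d 0 (-1)).hom ≃ₗ[R]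
      ModuleCat.of R (M →ₗ[R] N)) := by
  have hs : PinchIndex 0 0 0 := by unfold PinchIndex; omega
  let π : T.X 0 →ₗ[R] M := eM.toLinearMap ∘ₗ Submodule.mkQ _
  let ι : N →ₗ[R] U.X 0 := Submodule.subtype _ ∘ₗ eN.symm.toLinearMap
  have hπ : Function.Surjective π := eM.surjective.comp (Submodule.mkQ_surjective _)
  have hι : Function.Injective ι := Subtype.val_injective.comp eN.symm.injective
  have hπd : π ∘ₗ (T.d 1 0).hom = 0 := LinearMap.ext fun x => by simp [π]
  have hιd : (U.d 0 (-1)).hom ∘ₗ ι = 0 := LinearMap.ext fun x => (eN.symm x).2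
  let F : (M →ₗ[R] N) →ₗ[R] Pinched T U 0 :=
    { toFun := fun g => Pinched.single hs (ι ∘ₗ g ∘ₗ π)
      map_add' := fun g g' => by
        rw [LinearMap.add_comp, LinearMap.comp_add]
        exact Pi.single_add _ _ _
      map_smul' := fun r g => by
        rw [LinearMap.smul_comp, LinearMap.comp_smul]
        exact Pi.single_smul _ _ _ }
  have hF : Function.Injective F := by
    intro g g' h
    have h' : ι ∘ₗ g ∘ₗ π = ι ∘ₗ g' ∘ₗ π := by
      simpa [F] using congrArg (fun φ => φ.comp 0 0) h
    refine LinearMap.ext fun x => ?_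
    obtain ⟨t, rfl⟩ := hπ x
    exact hι (LinearMap.congr_fun h' t)
  have hr : LinearMap.range F = LinearMap.ker (pinchedD T U 0 (-1)) := by
    apply le_antisymm
    · rintro _ ⟨g, rfl⟩
      refine Pinched.ext_comp fun p q hpq => ?_
      rw [pinchedD_comp (by omega) hpq rfl rfl, Pinched.comp_zero]
      obtain ⟨rfl, rfl⟩ | ⟨rfl, rfl⟩ : (p = 0 ∧ q = -1) ∨ (p = 1 ∧ q = 0) := by
        unfold PinchIndex at hpq; omega
      · have h0 : (F g).comp (0 - 1) (-1) = 0 := Pinched.comp_single_of_ne _ _ (by omega)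
        have h1 : (F g).comp 0 (-1 + 1) = ι ∘ₗ g ∘ₗ π := Pinched.comp_single_same _ _
        rw [h0, h1]
        simp [← LinearMap.comp_assoc, hιd]
      · have h0 : (F g).comp 1 (0 + 1) = 0 := Pinched.comp_single_of_ne _ _ (by omega)
        have h1 : (F g).comp (1 - 1) 0 = ι ∘ₗ g ∘ₗ π := Pinched.comp_single_same _ _
        rw [h0, h1]
        simp [LinearMap.comp_assoc, hπd]
    · intro φ hφ
      -- Degree 0 has the single component `T_0 → U_0`. Its boundary has two components, saying that
      -- it lands in the kernel and kills the image of `T_1`.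
      have h1 : (U.d 0 (-1)).hom ∘ₗ φ.comp 0 0 = 0 := by
        rw [← pinchedD_zero_comp, LinearMap.mem_ker.1 hφ, Pinched.comp_zero]
      have h2 : φ.comp 0 0 ∘ₗ (T.d 1 0).hom = 0 := by
        have := congrArg (fun φ => φ.comp 1 0) (LinearMap.mem_ker.1 hφ)
        simp only [Pinched.comp_zero] at this
        rw [pinchedD_comp (p' := 0) (q' := 1) (by omega) (by unfold PinchIndex; omega) rfl rfl,
          φ.comp_eq_zero (p := 1) (by unfold PinchIndex; omega)] at this
        simpa using this
      let g : M →ₗ[R] N := eN.toLinearMap ∘ₗ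
        (LinearMap.codRestrict _ (Submodule.liftQ _ (φ.comp 0 0) (by
          rintro _ ⟨x, rfl⟩
          exact LinearMap.congr_fun h2 x)) (fun x => by
          obtain ⟨t, rfl⟩ := Submodule.mkQ_surjective _ x
          exact LinearMap.congr_fun h1 t)) ∘ₗ eM.symm.toLinearMap
      refine ⟨g, Pinched.ext_comp fun p q hpq => ?_⟩
      obtain ⟨rfl, rfl⟩ : p = 0 ∧ q = 0 := by unfold PinchIndex at hpq; omega
      refine (Pinched.comp_single_same _ _).trans (LinearMap.ext fun t => ?_)
      simp [g, ι, π]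
  rw [pinchedHom_d_hom (by omega)]
  exact ⟨((LinearEquiv.ofInjective F hF).trans (LinearEquiv.ofEq _ _ hr)).symm⟩

end

end PinchedHom

/-! ### The corollary -/

theorem mainTheorem7 {R : Type u} [CommRing R] [Small.{v} R]
    (M N : ModuleCat.{v} R) (T U : ChainComplex (ModuleCat.{v} R) ℤ)
    (hM : PinchedHom.IsGorensteinProjective M)
    (hT : PinchedHom.IsCompleteProjectiveResolution T M)
    (hN : PinchedHom.IsGorensteinInjective N)
    (hU : PinchedHom.IsCompleteInjectiveResolution U N)
    (hvan : ∀ i : ℤ, Limits.IsZero (PinchedHom.tateExt T N i)) :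
    (∀ n : ℤ, Module.Injective R ((PinchedHom.pinchedHom T U).X n)) ∧
    (PinchedHom.pinchedHom T U).Acyclic ∧
    (PinchedHom.IsTotallyAcyclicInjective (PinchedHom.pinchedHom T U) ↔
      ∀ J : ModuleCat.{v} R, Module.Injective R J →
        ∀ i : ℤ, Limits.IsZero (PinchedHom.tateExt T (ModuleCat.of R (J →ₗ[R] N)) i)) ∧
    (PinchedHom.IsTotallyAcyclicInjective (PinchedHom.pinchedHom T U) →
      PinchedHom.IsGorensteinInjective (ModuleCat.of R (M →ₗ[R] N)) ∧
      PinchedHom.IsCompleteInjectiveResolution (PinchedHom.pinchedHom T U)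
        (ModuleCat.of R (M →ₗ[R] N))) := by
  obtain ⟨eM⟩ := hT.coker
  obtain ⟨eN⟩ := hU.ker
  let ι : N →ₗ[R] U.X 0 := Submodule.subtype _ ∘ₗ eN.symm.toLinearMap
  have hι : Function.Injective ι := Subtype.val_injective.comp eN.symm.injective
  have hr : LinearMap.range ι = LinearMap.ker (U.d 0 (-1)).hom := by simp [ι, LinearMap.range_comp]
  have hinj := PinchedHom.injective_pinchedHom hT.totallyAcyclic.projective
    hU.totallyAcyclic.injective
  have hac : (PinchedHom.pinchedHom T U).Acyclic :=
    (PinchedHom.acyclic_pinchedHom_iff hT.totallyAcyclic.projective hU.totallyAcyclic.acyclic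
      hι hr).2 ((PinchedHom.isZero_tateExt_iff T N).1 hvan)
  have hJ (J : ModuleCat.{v} R) (hJ : Module.Injective R J) :
      (PinchedHom.homFromModule J (PinchedHom.pinchedHom T U)).Acyclic ↔
        ∀ i, Limits.IsZero (PinchedHom.tateExt T (ModuleCat.of R (J →ₗ[R] N)) i) := by
    rw [PinchedHom.isZero_tateExt_iff, PinchedHom.acyclic_homFromModule_pinchedHom_iff]
    -- Total acyclicity of `U` makes `Hom(J, U)` acyclic, and left exactness of `Hom(J, -)`
    -- identifies its cycles in degree 0 with `Hom(J, N)`.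
    refine PinchedHom.acyclic_pinchedHom_iff (A := PinchedHom.homFromModule J U)
      (L := ModuleCat.of R (J →ₗ[R] N)) hT.totallyAcyclic.projective
      (hU.totallyAcyclic.hom_acyclic J hJ) (ι := (ι.compRight R : (J →ₗ[R] N) →ₗ[R] _)) ?_ ?_
    · intro f g h
      exact LinearMap.ext fun x => hι (LinearMap.congr_fun (M := J) (M₃ := U.X 0) h x)
    · apply le_antisymm
      · rintro _ ⟨f, rfl⟩
        refine LinearMap.ext (M := J) (M₃ := U.X (-1)) fun x => ?_
        exact hr.le (LinearMap.mem_range_self ι (f x))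
      · intro f hf
        obtain ⟨g, hg⟩ := PinchedHom.exists_factor_ker hι hr (f : J →ₗ[R] U.X 0) hf
        exact ⟨g, hg⟩
  refine ⟨hinj, hac, ⟨fun h J hJ' => (hJ J hJ').1 (h.hom_acyclic J hJ'),
    fun h => ⟨hinj, hac, fun J hJ' => (hJ J hJ').2 (h J hJ')⟩⟩, fun h => ?_⟩
  have hres : PinchedHom.IsCompleteInjectiveResolution (PinchedHom.pinchedHom T U)
      (ModuleCat.of R (M →ₗ[R] N)) := ⟨h, PinchedHom.nonempty_ker_pinchedHom_equiv eM eN⟩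
  exact ⟨⟨_, hres⟩, hres⟩
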